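/- Let $\Delta_3$ be the standard $3$-dimensional simplex and $\partial\Delta_3$ its boundary (the union of its proper faces). Let $q\colon\Delta_3\to S^3$ be a map that collapses the boundary, that is, the quotient projection $\Delta_3\to\Delta_3/\partial\Delta_3$ followed by an arbitrary homeomorphism $\Delta_3/\partial\Delta_3\cong S^3$. Let $h\colon S^3\to S^2$ be the Hopf map, $h(z,w)=(2\,\mathrm{Re}(z\bar w),\,2\,\mathrm{Im}(z\bar w),\,|z|^2-|w|^2)$ on $S^3=\{(z,w)\in\mathbb C^2:|z|^2+|w|^2=1\}$, and let $f=h\circ q\colon\Delta_3\to S^2$. Then $f$ does not factor over $\mathbb R^2$: there are no continuous maps $f'\colon\Delta_3\to\mathbb R^2$ and $g\colon\mathbb R^2\to S^2$ with $f=g\circ f'$. -/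

import Mathlib

noncomputable section

namespace HopfSimplex

open Metric Topology

/-- The (geometric) standard `n`-simplex, with vertices indexed by `Fin (n + 1)`. -/
abbrev Simplex (n : ℕ) : Type := stdSimplex ℝ (Fin (n + 1))

/-- The boundary of the `n`-simplex: the union of its proper faces, i.e. the points at least one of
whose barycentric coordinates vanishes. -/
def simplexBoundary (n : ℕ) : Set (Simplex n) := {x | ∃ i, x.1 i = 0}

/-- The sphere `S³`, as the unit sphere of `ℂ²` (with its Hermitian norm). -/
abbrev S3 : Type := sphere (0 : EuclideanSpace ℂ (Fin 2)) 1

/-- The sphere `S²`, as the unit sphere of Euclidean `ℝ³`. -/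
abbrev S2 : Type := sphere (0 : EuclideanSpace ℝ (Fin 3)) 1

/-- `q : X → Y` collapses the subset `A` to a point: it is a topological quotient map whose only
identifications are those between points of `A`. Equivalently, `q` is the projection `X → X / A`
followed by a homeomorphism `X / A ≃ₜ Y`. -/
structure IsCollapse {X Y : Type*} [TopologicalSpace X] [TopologicalSpace Y]
    (A : Set X) (q : X → Y) : Prop where
  isQuotientMap : IsQuotientMap q
  eq_iff : ∀ x y, q x = q y ↔ x = y ∨ (x ∈ A ∧ y ∈ A)

/-- The formula `(z, w) ↦ (2 Re (z w̄), 2 Im (z w̄), |z|² - |w|²)`. -/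
def hopfVec (p : EuclideanSpace ℂ (Fin 2)) : EuclideanSpace ℝ (Fin 3) :=
  !₂[2 * (p 0 * starRingEnd ℂ (p 1)).re, 2 * (p 0 * starRingEnd ℂ (p 1)).im,
    ‖p 0‖ ^ 2 - ‖p 1‖ ^ 2]

theorem norm_hopfVec (p : EuclideanSpace ℂ (Fin 2)) (hp : p ∈ sphere 0 1) :
    hopfVec p ∈ sphere 0 1 := by
  rw [mem_sphere_zero_iff_norm, EuclideanSpace.norm_eq, Real.sqrt_eq_one] at hp ⊢
  simp only [Fin.sum_univ_two, Complex.sq_norm, Complex.normSq_apply] at hp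
  simp only [hopfVec, Fin.sum_univ_three, Real.norm_eq_abs, sq_abs, Complex.sq_norm,
    Complex.normSq_apply, Complex.mul_re, Complex.mul_im, Complex.conj_re, Complex.conj_im,
    PiLp.toLp_apply, Matrix.cons_val]
  calc _ = ((p 0).re * (p 0).re + (p 0).im * (p 0).im +
        ((p 1).re * (p 1).re + (p 1).im * (p 1).im)) ^ 2 := by ring
    _ = 1 := by rw [hp, one_pow]

/-- The Hopf map `S³ → S²`. -/
def hopfMap (p : S3) : S2 := ⟨hopfVec p, norm_hopfVec p p.2⟩

/-- The map `f : X → M` factors over `ℝᵈ`: it is a composite `X → ℝᵈ → M` of continuous maps. -/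
def FactorsOver (d : ℕ) {X M : Type*} [TopologicalSpace X] [TopologicalSpace M]
    (f : X → M) : Prop :=
  ∃ (f' : X → EuclideanSpace ℝ (Fin d)) (g : EuclideanSpace ℝ (Fin d) → M),
    Continuous f' ∧ Continuous g ∧ f = g ∘ f'

/-! The boundary of `Δ₃` can indeed be collapsed so as to obtain `S³`. -/

/-- The open simplex is parametrized by `ℝⁿ`. -/
def softmax (n : ℕ) : OpenPartialHomeomorph (Fin n → ℝ) (Simplex n) where
  toFun v := ⟨fun i => Real.exp ((Fin.cons 0 v : Fin (n + 1) → ℝ) i) /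
      ∑ j, Real.exp ((Fin.cons 0 v : Fin (n + 1) → ℝ) j),
    fun i => by positivity, by
      rw [← Finset.sum_div]
      exact div_self (by positivity)⟩
  invFun x := fun i => Real.log (x.1 i.succ) -
    Real.log (x.1 0)
  source := Set.univ
  target := (simplexBoundary n)ᶜ
  map_source' v _ := by
    rintro ⟨i, hi⟩
    have : 0 < Real.exp ((Fin.cons 0 v : Fin (n + 1) → ℝ) i) /
      ∑ j, Real.exp ((Fin.cons 0 v : Fin (n + 1) → ℝ) j) := by positivity
    exact this.ne' hi
  map_target' _ _ := Set.mem_univ _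
  left_inv' v _ := by
    ext i
    have h : (∑ j, Real.exp ((Fin.cons 0 v : Fin (n + 1) → ℝ) j)) ≠ 0 := by positivity
    change Real.log (Real.exp _ / _) - Real.log (Real.exp _ / _) = _
    rw [Real.log_div (Real.exp_ne_zero _) h, Real.log_div (Real.exp_ne_zero _) h]
    simp
  right_inv' x hx := by
    have hpos : ∀ i, 0 < x.1 i := fun i =>
      lt_of_le_of_ne (x.2.1 i) fun h => hx ⟨i, h.symm⟩
    have key : ∀ i, Real.exp ((Fin.cons 0 (fun i : Fin n =>
        Real.log (x.1 i.succ) - Real.log (x.1 0)) :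
          Fin (n + 1) → ℝ) i) = x.1 i / x.1 0 := by
      intro i
      refine Fin.cases ?_ (fun i => ?_) i
      · simp [(hpos 0).ne']
      · simp [Real.exp_sub, Real.exp_log (hpos _)]
    refine Subtype.ext (funext fun i => ?_)
    change Real.exp _ / ∑ j, Real.exp _ = _
    simp only [key]
    rw [← Finset.sum_div, x.2.2]
    field_simp [(hpos 0).ne']
  open_source := isOpen_univ
  open_target := by
    have : (simplexBoundary n)ᶜ = ⋂ i, {x : Simplex n | x.1 i ≠ 0} := by
      ext x
      simp [simplexBoundary]
    rw [this]
    exact isOpen_iInter_of_finite fun i => isOpen_ne_fun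
      ((continuous_apply i).comp continuous_subtype_val) continuous_const
  continuousOn_toFun := by
    refine Continuous.continuousOn (Continuous.subtype_mk (continuous_pi fun i => ?_) _)
    have hc : ∀ i, Continuous fun v : Fin n → ℝ =>
        Real.exp ((Fin.cons 0 v : Fin (n + 1) → ℝ) i) := by
      intro i
      refine Fin.cases ?_ (fun i => ?_) i
      · simpa using continuous_const
      · simpa using (continuous_apply i).rexp
    exact (hc i).div (continuous_finsetSum _ fun j _ => hc j) fun v => by positivity
  continuousOn_invFun := by
    refine continuousOn_pi.2 fun i => ContinuousOn.sub ?_ ?_ <;>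
    · refine ContinuousOn.log
        ((continuous_apply _).comp continuous_subtype_val).continuousOn fun x hx h => hx ⟨_, h⟩

theorem exists_isCollapse_onePoint {X K : Type*} [TopologicalSpace X] [TopologicalSpace K]
    [CompactSpace K] [T2Space K] [T2Space (OnePoint X)] {s : X → K} (hs : IsOpenEmbedding s)
    (hne : (Set.range s)ᶜ.Nonempty) :
    ∃ q : K → OnePoint X, IsCollapse (Set.range s)ᶜ q := by
  classical
  let q : K → OnePoint X := fun k => if h : k ∈ Set.range s then ((h.choose : X) : OnePoint X) else
    OnePoint.infty
  have q1 : ∀ x, q (s x) = (x : OnePoint X) := fun x => by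
    have h : s x ∈ Set.range s := ⟨x, rfl⟩
    simp only [q, dif_pos h]
    rw [hs.injective h.choose_spec]
  have q2 : ∀ k, k ∉ Set.range s → q k = OnePoint.infty := fun k h => by simp only [q, dif_neg h]
  have hcont : Continuous q := by
    refine continuous_def.2 fun t ht => ?_
    by_cases hi : OnePoint.infty ∈ t
    · have hk := ((OnePoint.isOpen_iff_of_mem hi).1 ht).2
      have : q ⁻¹' t = (s '' ((fun x : X => (x : OnePoint X)) ⁻¹' t)ᶜ)ᶜ := by
        ext k
        by_cases h : k ∈ Set.range s
        · obtain ⟨x, rfl⟩ := h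
          simp [q1, hs.injective.eq_iff]
        · simp only [Set.mem_preimage, q2 k h, hi, true_iff]
          rintro ⟨x, -, rfl⟩
          exact h ⟨x, rfl⟩
      rw [this]
      exact (hk.image hs.continuous).isClosed.isOpen_compl
    · have hk := (OnePoint.isOpen_iff_of_notMem hi).1 ht
      have : q ⁻¹' t = s '' ((fun x : X => (x : OnePoint X)) ⁻¹' t) := by
        ext k
        by_cases h : k ∈ Set.range s
        · obtain ⟨x, rfl⟩ := h
          simp [q1, hs.injective.eq_iff]
        · simp only [Set.mem_preimage, q2 k h, hi, false_iff]
          rintro ⟨x, -, rfl⟩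
          exact h ⟨x, rfl⟩
      rw [this]
      exact hs.isOpenMap _ hk
  have hsurj : Function.Surjective q := by
    intro y
    induction y using OnePoint.rec with
    | infty => exact ⟨hne.some, q2 _ hne.some_mem⟩
    | coe x => exact ⟨s x, q1 x⟩
  refine ⟨q, hcont.isClosedMap.isQuotientMap hcont hsurj, fun x y => ?_⟩
  by_cases hx : x ∈ Set.range s <;> by_cases hy : y ∈ Set.range s
  · obtain ⟨a, rfl⟩ := hx
    obtain ⟨b, rfl⟩ := hy
    simp [q1, hs.injective.eq_iff]
  · obtain ⟨a, rfl⟩ := hx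
    have : s a ≠ y := fun h => hy ⟨a, h⟩
    simp [q1, q2 y hy, this]
  · obtain ⟨b, rfl⟩ := hy
    have : x ≠ s b := fun h => hx ⟨b, h.symm⟩
    simp [q1, q2 x hx, this]
  · simp only [q2 x hx, q2 y hy, true_iff]
    exact Or.inr ⟨hx, hy⟩

theorem exists_isCollapse_simplexBoundary :
    ∃ q : Simplex 3 → S3, IsCollapse (simplexBoundary 3) q := by
  have hs : IsOpenEmbedding (softmax 3) := (softmax 3).isOpenEmbedding rfl
  have hr : (Set.range (softmax 3))ᶜ = simplexBoundary 3 := by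
    have := (softmax 3).image_source_eq_target
    rw [show (softmax 3).source = Set.univ from rfl, Set.image_univ] at this
    rw [this]
    exact compl_compl _
  have hne : (simplexBoundary 3).Nonempty :=
    ⟨⟨Pi.single 0 1, single_mem_stdSimplex ℝ 0⟩, 1, by simp⟩
  obtain ⟨q, hq⟩ := exists_isCollapse_onePoint hs (hr ▸ hne)
  rw [hr] at hq
  let v : EuclideanSpace ℂ (Fin 2) := EuclideanSpace.single 0 1
  have hv : ‖v‖ = 1 := by simp [v]
  have hv0 : v ≠ 0 := fun h => by simp [h] at hv
  have hfr : Module.finrank ℝ (EuclideanSpace ℂ (Fin 2)) = 3 + 1 := by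
    rw [← Module.finrank_mul_finrank ℝ ℂ (EuclideanSpace ℂ (Fin 2)), Complex.finrank_real_complex,
      finrank_euclideanSpace]
    rfl
  have : Fact (Module.finrank ℝ (EuclideanSpace ℂ (Fin 2)) = 3 + 1) := ⟨hfr⟩
  have hV : Module.finrank ℝ (Fin 3 → ℝ) = Module.finrank ℝ (Submodule.span ℝ {v})ᗮ := by
    rw [Submodule.finrank_orthogonal_span_singleton (n := 3) hv0]
    simp
  let e : (Fin 3 → ℝ) ≃ₜ (Submodule.span ℝ {v})ᗮ :=
    (FiniteDimensional.nonempty_continuousLinearEquiv_of_finrank_eq hV).some.toHomeomorph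
  let e' : OnePoint (Fin 3 → ℝ) ≃ₜ S3 :=
    e.onePointCongr.trans (onePointHyperplaneHomeoUnitSphere hv)
  exact ⟨e' ∘ q, e'.isQuotientMap.comp hq.isQuotientMap, fun x y => by
    simp only [Function.comp_apply, e'.injective.eq_iff, hq.eq_iff]⟩

end HopfSimplex

end

/-! Suppose `f = g ∘ f'`. Over a ball containing the compact image of `f'`, `g` lifts through the
Hopf map to `G` (`exists_hopf_lift`). Then `G ∘ f'` and `q` are two lifts of `f`, so they differ by
a phase `exp (iθ)`, with `θ` a continuous real function because the simplex is contractible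
(`exists_angle`). The pair `F = (f', θ)` determines `q`, so it maps the open simplex injectively
into `ℝ² × ℝ`, with open image by invariance of domain (`isOpen_range_of_finrank_eq`).

The boundary goes to a single point of `S²`. Take `x₀` with `f x₀` different from that point. On the
vertical line over `f' x₀`, the image of `F` comes from the open simplex alone, so it is open; it is
also compact and nonempty. No subset of `ℝ` is all three.

Invariance of domain is deduced from a zero theorem of Brouwer type
(`exists_zero_of_norm_sub_le_one`), which rests on the absence of a `C¹` retraction of the ball onto
its sphere, proved by a volume computation. -/

noncomputable section

namespace HopfSimplex

open Metric Topology MeasureTheory Set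

/-! ### Brouwer's theorem by volume and polynomial extrapolation -/

section Brouwer

open Polynomial

/-- Extrapolation of polynomials of bounded degree from points close to `0`. -/
theorem exists_eval_one_eq_sum (n : ℕ) {ε : ℝ} (hε : 0 < ε) :
    ∃ (s : Finset ℝ) (w : ℝ → ℝ), (∀ t ∈ s, 0 < t ∧ t < ε) ∧
      ∀ p : ℝ[X], p.natDegree ≤ n → p.eval 1 = ∑ t ∈ s, w t * p.eval t := by
  obtain ⟨s, hs, hcard⟩ := (Set.Ioo_infinite hε).exists_subset_card_eq (n + 1)
  refine ⟨s, fun t => (Lagrange.basis s id t).eval 1, fun t ht => hs ht, fun p hp => ?_⟩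
  have hdeg : p.degree < s.card := by
    rw [hcard]
    exact (degree_le_natDegree).trans_lt (by exact_mod_cast Nat.lt_succ_of_le hp)
  conv_lhs => rw [Lagrange.eq_interpolate (s := s) (v := id) (injOn_id _) hdeg]
  rw [Lagrange.interpolate_apply, eval_finsetSum]
  exact Finset.sum_congr rfl fun t _ => by simp [mul_comm]

section Det

variable {E : Type*} [NormedAddCommGroup E] [NormedSpace ℝ E] [FiniteDimensional ℝ E]

/-- The degree bound depends only on the dimension, so a single set of extrapolation weights serves
the Jacobians at all points of the ball. -/
theorem exists_polynomial_eval_eq_det_one_add_smul (A : E →L[ℝ] E) :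
    ∃ p : ℝ[X], p.natDegree ≤ Module.finrank ℝ E ∧
      ∀ t : ℝ, p.eval t = (1 + t • A : E →L[ℝ] E).det := by
  classical
  let b := Module.finBasis ℝ E
  let M := LinearMap.toMatrix b b (A : E →ₗ[ℝ] E)
  refine ⟨(((X : ℝ[X]) • M.map C + (1 : Matrix _ _ ℝ).map C)).det, ?_, fun t => ?_⟩
  · simpa using natDegree_det_X_add_C_le M 1
  · change evalRingHom t _ = LinearMap.det ((1 + t • A : E →L[ℝ] E) : E →ₗ[ℝ] E)
    rw [← LinearMap.det_toMatrix b, RingHom.map_det]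
    congr 1
    ext i j
    simp [M, LinearMap.toMatrix_apply, Matrix.one_apply, Finsupp.single_apply, add_comm,
      apply_ite (eval t), eq_comm]
    exact mul_comm _ _

/-- For `0 ≤ s ≤ t` a kernel vector of `1 + s • A` would satisfy `‖x‖ ≤ s ‖A‖ ‖x‖`, so the
determinant never vanishes on the way from its value `1` at `s = 0`. -/
theorem det_one_add_smul_pos {A : E →L[ℝ] E} {t : ℝ} (ht : 0 ≤ t) (hA : t * ‖A‖ < 1) :
    0 < (1 + t • A : E →L[ℝ] E).det := by
  have hne : ∀ s ∈ Icc 0 t, (1 + s • A : E →L[ℝ] E).det ≠ 0 := by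
    intro s hs h0
    obtain ⟨x, hx, hx0⟩ := Submodule.exists_mem_ne_zero_of_ne_bot
      (LinearMap.bot_lt_ker_of_det_eq_zero h0).ne'
    have h1 : x = -(s • A x) := by
      have : x + s • A x = 0 := by simpa using hx
      exact eq_neg_of_add_eq_zero_left this
    have h2 : ‖x‖ ≤ s * (‖A‖ * ‖x‖) := by
      conv_lhs => rw [h1, norm_neg, norm_smul, Real.norm_of_nonneg hs.1]
      exact mul_le_mul_of_nonneg_left (A.le_opNorm x) hs.1
    have h3 : 0 < ‖x‖ := norm_pos_iff.2 hx0
    have h4 : s * ‖A‖ ≤ t * ‖A‖ := mul_le_mul_of_nonneg_right hs.2 (norm_nonneg _)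
    nlinarith
  obtain ⟨p, -, hp⟩ := exists_polynomial_eval_eq_det_one_add_smul A
  by_contra! hle
  obtain ⟨s, hs, h0⟩ := intermediate_value_Icc' ht p.continuous.continuousOn
    (show (0 : ℝ) ∈ Icc (p.eval t) (p.eval 0) by
      simp only [hp, zero_smul, add_zero, mem_Icc]
      exact ⟨hle, zero_le_one.trans_eq (LinearMap.det_id (M := E) (A := ℝ)).symm⟩)
  exact hne s hs ((hp s).symm.trans h0)

end Det

variable {E : Type*} [NormedAddCommGroup E] [InnerProductSpace ℝ E]

/-- The radial retraction onto the closed ball of radius `R`. -/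
def radialRetraction (R : ℝ) (x : E) : E := (R / max R ‖x‖) • x

theorem continuous_radialRetraction {R : ℝ} (hR : 0 < R) :
    Continuous (radialRetraction R : E → E) :=
  (continuous_const.div (continuous_const.max continuous_norm)
    fun _ => (lt_max_of_lt_left hR).ne').smul continuous_id

theorem norm_radialRetraction_le {R : ℝ} (hR : 0 < R) (x : E) : ‖radialRetraction R x‖ ≤ R := by
  have hm : 0 < max R ‖x‖ := lt_max_of_lt_left hR
  rw [radialRetraction, norm_smul, Real.norm_of_nonneg (by positivity), div_mul_eq_mul_div,
    div_le_iff₀ hm]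
  exact mul_le_mul_of_nonneg_left (le_max_right _ _) hR.le

theorem radialRetraction_of_norm_le {R : ℝ} (hR : 0 < R) {x : E} (hx : ‖x‖ ≤ R) :
    radialRetraction R x = x := by
  rw [radialRetraction, max_eq_left hx, div_self hR.ne', one_smul]

/-- A Lipschitz map on the unit ball that vanishes on the unit sphere stays Lipschitz when it is
extended by zero. -/
theorem lipschitzWith_indicator_closedBall {h : E → E} {K : NNReal}
    (hh : LipschitzOnWith K h (closedBall 0 1)) (h0 : ∀ x, ‖x‖ = 1 → h x = 0) :
    LipschitzWith K ((closedBall (0 : E) 1).indicator h) := by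
  have key : ∀ x y : E, x ∈ closedBall (0 : E) 1 → y ∉ closedBall (0 : E) 1 →
      dist (h x) 0 ≤ K * dist x y := by
    intro x y hx hy
    rw [mem_closedBall_zero_iff] at hx hy
    have hc : ContinuousOn (fun t : ℝ => ‖AffineMap.lineMap x y t‖) (Icc 0 1) :=
      (AffineMap.lineMap_continuous.norm).continuousOn
    -- The segment from `x` to `y` crosses the unit sphere, where `h` vanishes, at a point no
    -- farther from `x` than `y` is.
    obtain ⟨t, ht, h1⟩ := intermediate_value_Icc zero_le_one hc
      (show (1 : ℝ) ∈ _ by simpa using ⟨hx, (not_le.1 hy).le⟩)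
    have hz := hh.dist_le_mul x (by simpa using hx) (AffineMap.lineMap x y t) (by simpa using h1.le)
    rw [h0 _ h1] at hz
    refine hz.trans (mul_le_mul_of_nonneg_left ?_ K.2)
    rw [dist_left_lineMap, Real.norm_of_nonneg ht.1]
    exact mul_le_of_le_one_left dist_nonneg ht.2
  refine LipschitzWith.of_dist_le_mul fun x y => ?_
  by_cases hx : x ∈ closedBall (0 : E) 1 <;> by_cases hy : y ∈ closedBall (0 : E) 1
  · simpa [indicator_of_mem, hx, hy] using hh.dist_le_mul x hx y hy
  · simpa only [indicator_of_mem hx, indicator_of_notMem hy] using key x y hx hy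
  · simpa only [indicator_of_mem hy, indicator_of_notMem hx, dist_comm] using key y x hy hx
  · simp only [indicator_of_notMem hx, indicator_of_notMem hy, dist_self]
    positivity

variable [FiniteDimensional ℝ E]

/-- A differentiable map into the unit sphere has singular differential. -/
theorem det_fderiv_eq_zero_of_norm_eq_one {r : E → E} (hr : Differentiable ℝ r)
    (h1 : ∀ x, ‖r x‖ = 1) (x : E) : (fderiv ℝ r x).det = 0 := by
  by_contra hdet
  have hd := (hr x).hasFDerivAt
  have hin := (hd.inner ℝ hd)
  have hconst : (fun y => inner ℝ (r y) (r y)) = fun _ => (1 : ℝ) := by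
    ext y
    rw [real_inner_self_eq_norm_sq, h1, one_pow]
  rw [hconst] at hin
  have h0 := hin.unique (hasFDerivAt_const (1 : ℝ) x)
  -- Differentiating `⟨r, r⟩ = 1` shows that the range of the differential is orthogonal to `r x`;
  -- an invertible differential would have `r x` itself in its range.
  obtain ⟨v, hv⟩ := ((LinearMap.equivOfDetNeZero (fderiv ℝ r x : E →ₗ[ℝ] E) hdet).surjective (r x))
  have hv' : fderiv ℝ r x v = r x := hv
  have h2 := congrArg (fun L : E →L[ℝ] ℝ => L v) h0
  simp [hv', h1] at h2

/-- A small perturbation of the identity that fixes the outside of the unit ball and preserves the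
ball is a bijection of the ball. -/
theorem bijOn_closedBall_add_smul {h : E → E} {K : NNReal}
    (hh : LipschitzOnWith K h (closedBall 0 1)) (h0 : ∀ x, ‖x‖ = 1 → h x = 0)
    (h1 : ∀ x ∈ closedBall (0 : E) 1, x + h x ∈ closedBall (0 : E) 1) {t : ℝ} (ht : 0 ≤ t)
    (ht1 : t ≤ 1) (htK : t * K < 1) :
    BijOn (fun x => x + t • h x) (closedBall 0 1) (closedBall 0 1) := by
  have hL := lipschitzWith_indicator_closedBall hh h0
  refine ⟨fun x hx => ?_, fun x hx y hy hxy => ?_, fun y hy => ?_⟩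
  · have := (convex_closedBall (0 : E) 1) hx (h1 x hx) (sub_nonneg.2 ht1) ht (by ring)
    convert this using 1
    module
  · have hxy' : x - y = t • (h y - h x) := by
      have : x + t • h x = y + t • h y := hxy
      rw [smul_sub, sub_eq_sub_iff_add_eq_add, this, add_comm]
    have h2 := hh.dist_le_mul y hy x hx
    have h3 : dist x y = t * dist (h y) (h x) := by
      rw [dist_eq_norm, hxy', norm_smul, Real.norm_of_nonneg ht, dist_eq_norm]
    have h4 : dist x y ≤ t * (K * dist x y) := by
      conv_lhs => rw [h3]
      rw [dist_comm y x] at h2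
      exact mul_le_mul_of_nonneg_left h2 ht
    have h5 : 0 ≤ dist x y := dist_nonneg
    exact dist_le_zero.1 (by nlinarith)
  -- A preimage of `y` is a fixed point of `x ↦ y - t • h x`. Extending `h` by zero makes this a
  -- contraction of the whole space, and a fixed point outside the ball would be `y` itself.
  · let T : NNReal := ⟨t, ht⟩
    have hc : ContractingWith (T * K) (fun x => y - t • (closedBall (0 : E) 1).indicator h x) := by
      refine ⟨by exact_mod_cast htK, LipschitzWith.of_dist_le_mul fun a b => ?_⟩
      rw [dist_sub_left, dist_smul₀, Real.norm_of_nonneg ht, NNReal.coe_mul, mul_assoc]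
      exact mul_le_mul_of_nonneg_left (hL.dist_le_mul a b) ht
    have hx := hc.fixedPoint_isFixedPt
    set x := hc.fixedPoint with hxdef
    have hx' : y = x + t • (closedBall (0 : E) 1).indicator h x := by
      exact sub_eq_iff_eq_add.1 (show y - t • (closedBall (0 : E) 1).indicator h x = x from hx)
    have hxB : x ∈ closedBall (0 : E) 1 := by
      by_contra hn
      rw [indicator_of_notMem hn, smul_zero, add_zero] at hx'
      exact hn (hx' ▸ hy)
    exact ⟨x, hxB, by rw [indicator_of_mem hxB] at hx'; exact hx'.symm⟩

/-- There is no continuously differentiable retraction of a ball onto its boundary sphere. -/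
theorem no_contDiff_retraction {r : E → E} (hr : ContDiff ℝ 1 r) (h1 : ∀ x, ‖r x‖ = 1)
    (hid : ∀ x, ‖x‖ = 1 → r x = x) : False := by
  borelize E
  let μ : Measure E := Measure.addHaar
  let B : Set E := closedBall 0 1
  let h : E → E := fun x => r x - x
  have hh : ContDiff ℝ 1 h := hr.sub contDiff_id
  have hBc : IsCompact B := isCompact_closedBall 0 1
  have hfd : Continuous (fderiv ℝ h) := hh.continuous_fderiv (by norm_num)
  obtain ⟨C, hC⟩ := (hBc.image hfd).isBounded.exists_norm_le
  let K : NNReal := C.toNNReal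
  have hK : ∀ x ∈ B, ‖fderiv ℝ h x‖₊ ≤ K := fun x hx => by
    rw [← NNReal.coe_le_coe]
    exact (hC _ ⟨x, hx, rfl⟩).trans (Real.le_coe_toNNReal C)
  have hLip : LipschitzOnWith K h B :=
    (convex_closedBall (0 : E) 1).lipschitzOnWith_of_nnnorm_fderiv_le
      (fun x _ => hh.differentiable (by norm_num) x) hK
  -- Below this bound both `t ≤ 1` and `t * K < 1` hold.
  have hε : 0 < 1 / ((K : ℝ) + 1) := by positivity
  obtain ⟨s, w, hs, hw⟩ := exists_eval_one_eq_sum (Module.finrank ℝ E) hε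
  have hcont : ∀ t : ℝ, Continuous fun x => (1 + t • fderiv ℝ h x : E →L[ℝ] E).det := fun t =>
    ContinuousLinearMap.continuous_det.comp (continuous_const.add (hfd.const_smul t))
  have hvol : ∀ t ∈ s, ∫ x in B, (1 + t • fderiv ℝ h x : E →L[ℝ] E).det ∂μ = μ.real B := by
    intro t ht
    obtain ⟨ht0, htε⟩ := hs t ht
    rw [lt_div_iff₀ (by positivity)] at htε
    have hKn : (0 : ℝ) ≤ K := K.2
    have hbij : BijOn (fun x => x + t • h x) B B := bijOn_closedBall_add_smul hLip
      (fun x hx => by simp [h, hid x hx]) (fun x _ => by simp [h, h1]) ht0.le (by nlinarith)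
      (by nlinarith)
    have hder : ∀ x ∈ B, HasFDerivWithinAt (fun x => x + t • h x)
        (1 + t • fderiv ℝ h x : E →L[ℝ] E) B x := fun x _ =>
      ((hasFDerivAt_id x).add
        ((hh.differentiable (by norm_num) x).hasFDerivAt.const_smul t)).hasFDerivWithinAt
    have hi := integral_image_eq_integral_abs_det_fderiv_smul μ hBc.measurableSet hder
      hbij.injOn (fun _ => (1 : ℝ))
    rw [hbij.image_eq] at hi
    simp only [smul_eq_mul, mul_one, integral_const, measureReal_restrict_apply_univ] at hi
    rw [hi]
    refine setIntegral_congr_fun hBc.measurableSet fun x hx => (abs_of_pos ?_).symm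
    have := hK x hx
    have hKx : ‖fderiv ℝ h x‖ ≤ K := by exact_mod_cast this
    exact det_one_add_smul_pos ht0.le (by nlinarith [mul_le_mul_of_nonneg_left hKx ht0.le])
  -- The volume identity for small `t` extrapolates to `t = 1`, where the Jacobian is that of `r`
  -- and vanishes identically.
  have hone : ∫ x in B, (1 + (1 : ℝ) • fderiv ℝ h x : E →L[ℝ] E).det ∂μ = μ.real B := by
    have hpt : ∀ x, (1 + (1 : ℝ) • fderiv ℝ h x : E →L[ℝ] E).det =
        ∑ t ∈ s, w t * (1 + t • fderiv ℝ h x : E →L[ℝ] E).det := fun x => by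
      obtain ⟨p, hp, hev⟩ := exists_polynomial_eval_eq_det_one_add_smul (fderiv ℝ h x)
      simpa only [hev] using hw p hp
    simp only [hpt]
    have hint : ∀ t ∈ s, IntegrableOn
        (fun x => w t * (1 + t • fderiv ℝ h x : E →L[ℝ] E).det) B μ := fun t _ =>
      (continuous_const.mul (hcont t)).continuousOn.integrableOn_compact hBc
    rw [integral_finsetSum _ hint]
    rw [Finset.sum_congr rfl fun t ht => by rw [integral_const_mul, hvol t ht], ← Finset.sum_mul]
    -- The constant polynomial `1` shows that the weights sum to `1`.
    have := hw 1 (by simp)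
    simp only [eval_one, mul_one] at this
    rw [← this, one_mul]
  have hzero : ∀ x, (1 + (1 : ℝ) • fderiv ℝ h x : E →L[ℝ] E).det = 0 := fun x => by
    have : (1 + (1 : ℝ) • fderiv ℝ h x : E →L[ℝ] E) = fderiv ℝ r x := by
      have h2 : fderiv ℝ h x = fderiv ℝ r x - ContinuousLinearMap.id ℝ E := by
        exact ((hr.differentiable (by norm_num) x).hasFDerivAt.sub (hasFDerivAt_id x)).fderiv
      rw [h2, one_smul]
      exact add_sub_cancel _ _
    rw [this]
    exact det_fderiv_eq_zero_of_norm_eq_one (hr.differentiable (by norm_num)) h1 x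
  simp only [hzero, integral_zero] at hone
  exact (measureReal_ne_zero_iff hBc.measure_lt_top.ne).2
    (measure_closedBall_pos μ 0 one_pos).ne' hone.symm

/-- A continuous self-map of Euclidean space that is the identity far away has a zero. -/
theorem exists_zero_of_eq_id_outside {v : E → E} (hv : Continuous v) {R : ℝ} (hR : 0 < R)
    (hid : ∀ x, R ≤ ‖x‖ → v x = x) : ∃ x, v x = 0 := by
  by_contra! hne
  -- An error smaller than `‖v x‖` keeps the smooth approximation `g` away from zero. Rescaling by
  -- `2 * R` and normalizing then gives a forbidden retraction.
  obtain ⟨g, hg, happ, heq, -⟩ := hv.exists_contDiff_approx_and_eqOn (ε := fun x => ‖v x‖) 1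
    hv.norm (fun x => norm_pos_iff.2 (hne x)) (S := {x | 2 * R ≤ ‖x‖}) (U := {x | R < ‖x‖})
    (isClosed_le continuous_const continuous_norm)
    ((isOpen_lt continuous_const continuous_norm).mem_nhdsSet.2 fun x hx => by
      have : 2 * R ≤ ‖x‖ := hx
      change R < ‖x‖
      linarith)
    (contDiffOn_id.congr fun x hx => hid x (le_of_lt hx))
  have hg0 : ∀ x, g x ≠ 0 := fun x h => by
    have := happ x
    rw [h, dist_zero_left] at this
    exact lt_irrefl _ this
  let k : E → E := fun x => g ((2 * R) • x)
  have hk : ContDiff ℝ 1 k := hg.comp (contDiff_const_smul _)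
  have hk0 : ∀ x, k x ≠ 0 := fun x => hg0 _
  refine no_contDiff_retraction (r := fun x => ‖k x‖⁻¹ • k x)
    (((hk.norm ℝ hk0).inv fun x => norm_ne_zero_iff.2 (hk0 x)).smul hk) (fun x => ?_) fun x hx => ?_
  · rw [norm_smul, norm_inv, norm_norm, inv_mul_cancel₀ (norm_ne_zero_iff.2 (hk0 x))]
  · have hn : ‖(2 * R) • x‖ = 2 * R := by
      rw [norm_smul, hx, mul_one, Real.norm_of_nonneg (by positivity)]
    have h2 : k x = (2 * R) • x := (heq (show 2 * R ≤ _ from hn.ge)).trans (hid _ (by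
      rw [hn]; linarith))
    simp only [h2, hn]
    rw [smul_smul, inv_mul_cancel₀ (by positivity), one_smul]

/-- A map of the unit ball that moves no point by more than the radius has a zero. -/
theorem exists_zero_of_norm_sub_le_one {v : E → E} (hv : ContinuousOn v (closedBall 0 1))
    (h : ∀ x ∈ closedBall (0 : E) 1, ‖v x - x‖ ≤ 1) : ∃ x ∈ closedBall (0 : E) 1, v x = 0 := by
  let π : E → E := radialRetraction 1
  have hπ : Continuous π := continuous_radialRetraction one_pos
  have hπB : ∀ x, π x ∈ closedBall (0 : E) 1 := fun x => by
    simpa using norm_radialRetraction_le one_pos x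
  -- A cutoff equal to `1` on the unit ball and `0` beyond radius `2`. A zero of the extended map
  -- satisfies `‖x‖ ≤ a x ≤ 1`, so it lies in the ball.
  let a : E → ℝ := fun x => max 0 (min 1 (2 - ‖x‖))
  obtain ⟨x, hx⟩ := exists_zero_of_eq_id_outside (v := fun x => x + a x • (v (π x) - π x))
    (R := 2) (continuous_id.add (Continuous.smul (by fun_prop)
      ((hv.comp_continuous hπ hπB).sub hπ))) two_pos fun x hx => by
    have : a x = 0 := max_eq_left ((min_le_right _ _).trans (by linarith))
    simp [this]
  by_cases hx1 : ‖x‖ ≤ 1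
  · have ha : a x = 1 := by
      simp only [a]
      rw [min_eq_left (by linarith), max_eq_right zero_le_one]
    have hπx : π x = x := radialRetraction_of_norm_le one_pos hx1
    refine ⟨x, by simpa using hx1, ?_⟩
    simpa [ha, hπx] using hx
  · exfalso
    have h2 : ‖x‖ = a x * ‖v (π x) - π x‖ := by
      have : x = -(a x • (v (π x) - π x)) := eq_neg_of_add_eq_zero_left hx
      conv_lhs => rw [this, norm_neg, norm_smul, Real.norm_of_nonneg (le_max_left _ _)]
    have h3 : a x ≤ 1 := max_le zero_le_one (min_le_left _ _)
    have h4 : ‖x‖ ≤ 1 := by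
      rw [h2]
      exact mul_le_one₀ h3 (norm_nonneg _) (h _ (hπB x))
    exact hx1 h4

end Brouwer

/-! ### Invariance of domain -/

section InvarianceOfDomain

variable {E : Type*} [NormedAddCommGroup E] [InnerProductSpace ℝ E] [FiniteDimensional ℝ E]

/-- A continuous injective map on a compact set has a continuous left inverse. -/
theorem exists_continuous_leftInvOn {f : E → E} {s : Set E} (hs : IsCompact s)
    (hf : ContinuousOn f s) (hinj : InjOn f s) :
    ∃ G : E → E, Continuous G ∧ LeftInvOn G f s := by
  have : CompactSpace s := isCompact_iff_compactSpace.1 hs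
  have he : IsClosedEmbedding (s.domRestrict f) :=
    (continuousOn_iff_continuous_domRestrict.1 hf).isClosedEmbedding hinj.injective
  obtain ⟨G, hG⟩ := ContinuousMap.exists_extension he
    (⟨Subtype.val, continuous_subtype_val⟩ : C(s, E))
  exact ⟨G, G.continuous, fun x hx => congrArg (fun k : C(s, E) => k ⟨x, hx⟩) hG⟩

/-- A continuous map can be approximated by maps that omit the value `0` on a given sphere. -/
theorem exists_continuous_approx_ne_zero_on_sphere {G : E → E} (hG : Continuous G) (c : E)
    {ε δ : ℝ} (hε : 0 < ε) (hδ : 0 < δ) :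
    ∃ P : E → E, Continuous P ∧ (∀ x, ‖P x - G x‖ < δ) ∧ ∀ x ∈ sphere c ε, P x ≠ 0 := by
  borelize E
  let μ : Measure E := Measure.addHaar
  obtain ⟨Q, hQ, hQG, -⟩ := hG.exists_contDiff_approx (ε := fun _ => δ / 2) 1 continuous_const
    fun _ => half_pos hδ
  -- A `C¹` map sends the null set `sphere c ε` to a null set, so an arbitrarily small translation
  -- moves the image off `0`.
  have hnull : μ (Q '' sphere c ε) = 0 :=
    addHaar_image_eq_zero_of_differentiableOn_of_addHaar_eq_zero μ
      (hQ.differentiable (by norm_num)).differentiableOn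
      (Measure.addHaar_sphere_of_ne_zero μ c hε.ne')
  obtain ⟨a, ha, hna⟩ : ∃ a ∈ ball (0 : E) (δ / 2), a ∉ Q '' sphere c ε := by
    by_contra! hsub
    exact (measure_ball_pos μ 0 (half_pos hδ)).ne' (measure_mono_null hsub hnull)
  refine ⟨fun x => Q x - a, hQ.continuous.sub continuous_const, fun x => ?_, fun x hx h => ?_⟩
  · have h1 := hQG x
    rw [dist_eq_norm] at h1
    rw [mem_ball_zero_iff] at ha
    calc ‖Q x - a - G x‖ = ‖(Q x - G x) - a‖ := by congr 1; abel
      _ ≤ ‖Q x - G x‖ + ‖a‖ := norm_sub_le _ _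
      _ < δ := by linarith
  · exact hna ⟨x, hx, sub_eq_zero.1 h⟩

/-- Otherwise some `c` near `f 0` is missed by the image. Let `G` extend the inverse of `f`, let `P`
approximate `G`, and let `Φ` push the image out of the ball of radius `ε` about `c`. The map `P ∘ Φ
∘ f` is close enough to the identity to have a zero, yet it has none: away from `c`, `G` is bounded
below, and on the sphere `P` was chosen nonvanishing. -/
theorem mem_interior_image_closedBall {f : E → E} (hf : ContinuousOn f (closedBall 0 1))
    (hinj : InjOn f (closedBall 0 1)) : f 0 ∈ interior (f '' closedBall 0 1) := by
  by_contra hint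
  have hB : IsCompact (closedBall (0 : E) 1) := isCompact_closedBall 0 1
  have h0B : (0 : E) ∈ closedBall (0 : E) 1 := mem_closedBall_self zero_le_one
  have hK : IsCompact (f '' closedBall 0 1) := hB.image_of_continuousOn hf
  obtain ⟨G, hG, hGf⟩ := exists_continuous_leftInvOn hB hf hinj
  obtain ⟨η, hη, hGη⟩ := Metric.continuous_iff.1 hG (f 0) (1 / 4) (by norm_num)
  rw [hGf h0B] at hGη
  simp only [dist_zero_right] at hGη
  -- If `f x` is within `ε` of `c`, then `f x` and `Φ (f x)` are both within `2 * ε < η` of `f 0`,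
  -- so `G` is smaller than `1 / 4` at both.
  let ε := η / 3
  have hε : 0 < ε := by positivity
  obtain ⟨c, hcb, hcK⟩ : ∃ c ∈ ball (f 0) ε, c ∉ f '' closedBall 0 1 := by
    by_contra! hsub
    exact hint (mem_interior.2 ⟨_, hsub, isOpen_ball, mem_ball_self hε⟩)
  rw [mem_ball] at hcb
  let S := f '' closedBall 0 1 ∩ {y | ε ≤ dist y c}
  have hS : IsCompact S :=
    hK.inter_right (isClosed_le continuous_const (continuous_id.dist continuous_const))
  have hGS : ∀ y ∈ S, 0 < ‖G y‖ := by
    rintro _ ⟨⟨x, hx, rfl⟩, hd⟩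
    rw [norm_pos_iff, hGf hx]
    rintro rfl
    rw [mem_ofPred_eq, dist_comm] at hd
    exact absurd hcb (not_lt.2 hd)
  obtain ⟨δ, hδ, hδS⟩ : ∃ δ > 0, ∀ y ∈ S, δ ≤ ‖G y‖ := by
    rcases S.eq_empty_or_nonempty with h | h
    · exact ⟨1, one_pos, by simp [h]⟩
    · obtain ⟨y, hy, hmin⟩ := hS.exists_isMinOn h hG.norm.continuousOn
      exact ⟨_, hGS y hy, fun z hz => hmin hz⟩
  obtain ⟨P, hP, hPG, hPs⟩ := exists_continuous_approx_ne_zero_on_sphere hG c hε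
    (lt_min hδ (by norm_num : (0 : ℝ) < 1 / 4))
  let Φ : E → E := fun y => c + max (ε / dist y c) 1 • (y - c)
  have hΦfar : ∀ y, ε ≤ dist y c → Φ y = y := fun y hy => by
    have : max (ε / dist y c) 1 = 1 := max_eq_right (div_le_one_of_le₀ hy dist_nonneg)
    simp [Φ, this]
  have hΦnear : ∀ y, y ≠ c → dist y c < ε → Φ y ∈ sphere c ε := fun y hyc hy => by
    have hd : 0 < dist y c := dist_pos.2 hyc
    have : max (ε / dist y c) 1 = ε / dist y c := max_eq_left ((one_le_div hd).2 hy.le)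
    rw [mem_sphere_iff_norm]
    simp only [Φ, this, add_sub_cancel_left, norm_smul, ← dist_eq_norm, norm_div,
      Real.norm_of_nonneg hε.le, Real.norm_of_nonneg hd.le]
    exact div_mul_cancel₀ _ hd.ne'
  have hΦc : ContinuousOn Φ (f '' closedBall 0 1) := by
    intro y hy
    have hd : dist y c ≠ 0 := dist_ne_zero.2 fun h => hcK (h ▸ hy)
    have hcont : Continuous fun y : E => dist y c := continuous_id.dist continuous_const
    exact (continuousAt_const.add (((continuousAt_const.div hcont.continuousAt hd).max
      continuousAt_const).smul (continuousAt_id.sub continuousAt_const))).continuousWithinAt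
  obtain ⟨x, hx, hx0⟩ := exists_zero_of_norm_sub_le_one (v := fun x => P (Φ (f x)))
    (hP.comp_continuousOn (hΦc.comp hf (mapsTo_image _ _))) fun x hx => by
      have h1 := (hPG (Φ (f x))).trans_le (min_le_right _ _)
      rcases le_or_gt ε (dist (f x) c) with hfar | hnear
      · rw [hΦfar _ hfar] at h1 ⊢
        rw [hGf hx] at h1
        linarith
      · have hs := hΦnear (f x) (fun h => hcK (h ▸ mem_image_of_mem f hx)) hnear
        rw [mem_sphere] at hs
        have h2 : ‖G (Φ (f x))‖ < 1 / 4 := hGη _ (by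
          have := dist_triangle (Φ (f x)) c (f 0)
          simp only [ε] at *
          linarith)
        have h3 : ‖G (f x)‖ < 1 / 4 := hGη _ (by
          have := dist_triangle (f x) c (f 0)
          simp only [ε] at *
          linarith)
        rw [hGf hx] at h3
        calc ‖P (Φ (f x)) - x‖ = ‖(P (Φ (f x)) - G (Φ (f x))) + G (Φ (f x)) - x‖ := by
              congr 1; abel
          _ ≤ ‖P (Φ (f x)) - G (Φ (f x))‖ + ‖G (Φ (f x))‖ + ‖x‖ :=
              (norm_sub_le _ _).trans (add_le_add_left (norm_add_le _ _) _)
          _ ≤ 1 := by linarith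
  rcases le_or_gt ε (dist (f x) c) with hfar | hnear
  · have h1 := (hPG (Φ (f x))).trans_le (min_le_left _ _)
    rw [hx0, hΦfar _ hfar, zero_sub, norm_neg] at h1
    exact absurd (hδS _ ⟨mem_image_of_mem f hx, hfar⟩) (not_le.2 h1)
  · exact hPs _ (hΦnear _ (fun h => hcK (h ▸ mem_image_of_mem f hx)) hnear) hx0

theorem isOpen_range_of_continuous_injective {f : E → E} (hf : Continuous f)
    (hinj : Function.Injective f) : IsOpen (range f) := by
  rw [← subset_interior_iff_isOpen]
  rintro _ ⟨x, rfl⟩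
  have h := mem_interior_image_closedBall (f := fun z => f (x + z))
    (hf.comp (continuous_const.add continuous_id)).continuousOn
    (fun a _ b _ hab => add_left_cancel (hinj hab))
  rw [add_zero] at h
  exact interior_mono (by rintro _ ⟨z, -, rfl⟩; exact mem_range_self _) h

end InvarianceOfDomain

/-- **Invariance of domain** for maps between vector spaces of the same finite dimension. -/
theorem isOpen_range_of_finrank_eq {V W : Type*} [NormedAddCommGroup V] [NormedSpace ℝ V]
    [FiniteDimensional ℝ V] [NormedAddCommGroup W] [NormedSpace ℝ W] [FiniteDimensional ℝ W]
    (hVW : Module.finrank ℝ V = Module.finrank ℝ W) {f : V → W} (hf : Continuous f)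
    (hinj : Function.Injective f) : IsOpen (range f) := by
  let a : EuclideanSpace ℝ (Fin (Module.finrank ℝ W)) ≃L[ℝ] V :=
    ContinuousLinearEquiv.ofFinrankEq (by rw [finrank_euclideanSpace_fin, hVW])
  let b : W ≃L[ℝ] EuclideanSpace ℝ (Fin (Module.finrank ℝ W)) :=
    ContinuousLinearEquiv.ofFinrankEq finrank_euclideanSpace_fin.symm
  have h := isOpen_range_of_continuous_injective (f := b ∘ f ∘ a)
    (b.continuous.comp (hf.comp a.continuous)) (b.injective.comp (hinj.comp a.injective))
  rw [range_comp, range_comp, a.surjective.range_eq, image_univ] at h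
  exact (b.toHomeomorph.isOpen_image).1 h

/-! ### The Hopf map and projection onto its fibres -/

/-- The orthogonal projection of `ℂ²` onto the complex line that corresponds to `b ∈ S²`. -/
def fiberProj (b : EuclideanSpace ℝ (Fin 3)) (p : EuclideanSpace ℂ (Fin 2)) :
    EuclideanSpace ℂ (Fin 2) :=
  !₂[((1 + b 2 : ℝ) * p 0 + (⟨b 0, b 1⟩ : ℂ) * p 1) / 2,
    ((⟨b 0, -b 1⟩ : ℂ) * p 0 + (1 - b 2 : ℝ) * p 1) / 2]

theorem continuous_fiberProj {X : Type*} [TopologicalSpace X] {b : X → EuclideanSpace ℝ (Fin 3)}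
    {p : X → EuclideanSpace ℂ (Fin 2)} (hb : Continuous b) (hp : Continuous p) :
    Continuous fun x => fiberProj (b x) (p x) := by
  have h : ∀ b : EuclideanSpace ℝ (Fin 3), ∀ σ : ℝ,
      (⟨b 0, σ * b 1⟩ : ℂ) = (b 0 : ℂ) + σ * (b 1 : ℂ) * Complex.I := fun b σ => by
    apply Complex.ext <;> simp
  have h1 := fun b => h b 1
  have h2 := fun b => h b (-1)
  simp only [one_mul, neg_mul] at h1 h2
  refine (PiLp.continuous_toLp 2 _).comp (continuous_pi fun i => ?_)
  fin_cases i
  · simp only [Fin.zero_eta, Matrix.cons_val_zero, h1]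
    fun_prop
  · simp only [Fin.mk_one, Matrix.cons_val_one, Matrix.cons_val_fin_one, h2]
    fun_prop

theorem norm_sq_eq (p : EuclideanSpace ℂ (Fin 2)) :
    ‖p‖ ^ 2 = (p 0).re ^ 2 + (p 0).im ^ 2 + ((p 1).re ^ 2 + (p 1).im ^ 2) := by
  rw [EuclideanSpace.norm_sq_eq, Fin.sum_univ_two]
  simp only [Complex.sq_norm, Complex.normSq_apply]
  ring

theorem hopfVec_apply_zero (p : EuclideanSpace ℂ (Fin 2)) :
    hopfVec p 0 = 2 * ((p 0).re * (p 1).re + (p 0).im * (p 1).im) := by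
  simp [hopfVec]

theorem hopfVec_apply_one (p : EuclideanSpace ℂ (Fin 2)) :
    hopfVec p 1 = 2 * ((p 0).im * (p 1).re - (p 0).re * (p 1).im) := by
  simp [hopfVec]
  ring

theorem hopfVec_apply_two (p : EuclideanSpace ℂ (Fin 2)) :
    hopfVec p 2 = (p 0).re ^ 2 + (p 0).im ^ 2 - ((p 1).re ^ 2 + (p 1).im ^ 2) := by
  simp [hopfVec, Complex.sq_norm, Complex.normSq_apply]
  ring

section Coordinates

variable (b : EuclideanSpace ℝ (Fin 3)) (p : EuclideanSpace ℂ (Fin 2))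

theorem fiberProj_zero_re : (fiberProj b p 0).re =
    ((1 + b 2) * (p 0).re + (b 0 * (p 1).re - b 1 * (p 1).im)) / 2 := by
  simp [fiberProj]

theorem fiberProj_zero_im : (fiberProj b p 0).im =
    ((1 + b 2) * (p 0).im + (b 0 * (p 1).im + b 1 * (p 1).re)) / 2 := by
  simp [fiberProj]

theorem fiberProj_one_re : (fiberProj b p 1).re =
    (b 0 * (p 0).re + b 1 * (p 0).im + (1 - b 2) * (p 1).re) / 2 := by
  simp [fiberProj]

theorem fiberProj_one_im : (fiberProj b p 1).im =
    (b 0 * (p 0).im - b 1 * (p 0).re + (1 - b 2) * (p 1).im) / 2 := by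
  simp [fiberProj]
  ring

variable {b}

theorem sum_sq_of_norm_eq_one (hb : ‖b‖ = 1) : b 0 ^ 2 + b 1 ^ 2 + b 2 ^ 2 = 1 := by
  have := EuclideanSpace.norm_sq_eq b
  simpa [hb, Fin.sum_univ_three] using this.symm

/-- For `p` on the sphere this shows that the projection vanishes only when `hopfVec p = -b`. -/
theorem norm_fiberProj_sq (hb : ‖b‖ = 1) :
    ‖fiberProj b p‖ ^ 2 = (‖p‖ ^ 2 + inner ℝ b (hopfVec p)) / 2 := by
  rw [norm_sq_eq, norm_sq_eq, PiLp.inner_apply, Fin.sum_univ_three]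
  simp only [RCLike.inner_apply, conj_trivial, hopfVec_apply_zero, hopfVec_apply_one,
    hopfVec_apply_two, fiberProj_zero_re, fiberProj_zero_im, fiberProj_one_re, fiberProj_one_im]
  linear_combination ((p 0).re ^ 2 + (p 0).im ^ 2 + ((p 1).re ^ 2 + (p 1).im ^ 2)) / 4 *
    sum_sq_of_norm_eq_one hb

theorem hopfVec_fiberProj (hb : ‖b‖ = 1) :
    hopfVec (fiberProj b p) = ‖fiberProj b p‖ ^ 2 • b := by
  have hb' := sum_sq_of_norm_eq_one hb
  rw [norm_fiberProj_sq p hb, norm_sq_eq, PiLp.inner_apply, Fin.sum_univ_three]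
  simp only [RCLike.inner_apply, conj_trivial, hopfVec_apply_zero, hopfVec_apply_one,
    hopfVec_apply_two]
  ext i
  rw [PiLp.smul_apply, smul_eq_mul]
  fin_cases i
  · change hopfVec (fiberProj b p) 0 = _ * b 0
    simp only [hopfVec_apply_zero, fiberProj_zero_re, fiberProj_zero_im, fiberProj_one_re,
      fiberProj_one_im]
    linear_combination -((p 0).re * (p 1).re + (p 0).im * (p 1).im) / 2 * hb'
  · change hopfVec (fiberProj b p) 1 = _ * b 1
    simp only [hopfVec_apply_one, fiberProj_zero_re, fiberProj_zero_im, fiberProj_one_re,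
      fiberProj_one_im]
    linear_combination -((p 0).im * (p 1).re - (p 0).re * (p 1).im) / 2 * hb'
  · change hopfVec (fiberProj b p) 2 = _ * b 2
    simp only [hopfVec_apply_two, fiberProj_zero_re, fiberProj_zero_im, fiberProj_one_re,
      fiberProj_one_im]
    linear_combination (-((p 0).re ^ 2 + (p 0).im ^ 2) + ((p 1).re ^ 2 + (p 1).im ^ 2)) / 4 * hb'

end Coordinates

theorem hopfVec_smul (r : ℝ) (p : EuclideanSpace ℂ (Fin 2)) :
    hopfVec (r • p) = r ^ 2 • hopfVec p := by
  ext i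
  fin_cases i <;> simp [hopfVec, mul_pow] <;> ring

/-- Only antipodal points of `S²` are at distance `2`, and the projection vanishes only for these.
-/
theorem fiberProj_ne_zero {b : S2} {p : S3} (h : dist b (hopfMap p) < 2) :
    fiberProj b p ≠ 0 := by
  intro h0
  have hb : ‖(b : EuclideanSpace ℝ (Fin 3))‖ = 1 := norm_eq_of_mem_sphere b
  have hp : ‖(p : EuclideanSpace ℂ (Fin 2))‖ = 1 := norm_eq_of_mem_sphere p
  have hh : ‖hopfVec p‖ = 1 := norm_eq_of_mem_sphere (hopfMap p)
  have h1 := norm_fiberProj_sq (p : EuclideanSpace ℂ (Fin 2)) hb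
  rw [h0, norm_zero, hp] at h1
  have h2 := norm_sub_sq_real (b : EuclideanSpace ℝ (Fin 3)) (hopfVec p)
  rw [hb, hh] at h2
  have h3 : ‖(b : EuclideanSpace ℝ (Fin 3)) - hopfVec p‖ < 2 := by
    rwa [← dist_eq_norm]
  nlinarith [norm_nonneg ((b : EuclideanSpace ℝ (Fin 3)) - hopfVec p)]

/-! ### Lifting through the Hopf map and through the circle -/

section Lift

variable {X : Type*} [TopologicalSpace X]

/-- If `k : X → S²` is nowhere antipodal to `hopfMap ∘ G`, then it lifts to `S³` by parallel
transport of `G`. -/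
theorem exists_lift_of_fiberProj_ne_zero {G : X → S3} (hG : Continuous G) {k : X → S2}
    (hk : Continuous k) (h : ∀ x, fiberProj (k x) (G x) ≠ 0) :
    ∃ G' : X → S3, Continuous G' ∧ ∀ x, hopfMap (G' x) = k x := by
  have hc : Continuous fun x => fiberProj (k x) (G x) :=
    continuous_fiberProj (continuous_subtype_val.comp hk) (continuous_subtype_val.comp hG)
  refine ⟨fun x => ⟨‖fiberProj (k x) (G x)‖⁻¹ • fiberProj (k x) (G x), ?_⟩, ?_, fun x => ?_⟩
  · rw [mem_sphere_zero_iff_norm, norm_smul, norm_inv, norm_norm,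
      inv_mul_cancel₀ (norm_ne_zero_iff.2 (h x))]
  · exact ((hc.norm.inv₀ fun x => norm_ne_zero_iff.2 (h x)).smul hc).subtype_mk _
  · apply Subtype.ext
    change hopfVec (_ • _) = _
    rw [hopfVec_smul, hopfVec_fiberProj _ (norm_eq_of_mem_sphere (k x)), smul_smul, ← mul_pow,
      inv_mul_cancel₀ (norm_ne_zero_iff.2 (h x)), one_pow, one_smul]

theorem exists_lift_of_chain {k : ℕ → X → S2} (hk : ∀ j, Continuous (k j)) {N : ℕ}
    (hd : ∀ j < N, ∀ x, dist (k (j + 1) x) (k j x) < 2)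
    (h0 : ∃ G : X → S3, Continuous G ∧ ∀ x, hopfMap (G x) = k 0 x) :
    ∃ G : X → S3, Continuous G ∧ ∀ x, hopfMap (G x) = k N x := by
  induction N with
  | zero => exact h0
  | succ N ih =>
    obtain ⟨G, hG, hGk⟩ := ih fun j hj => hd j (hj.trans (Nat.lt_succ_self N))
    exact exists_lift_of_fiberProj_ne_zero hG (hk (N + 1)) fun x => fiberProj_ne_zero (by
      rw [hGk]
      exact hd N (Nat.lt_succ_self N) x)

/-- The diagonal entries `(1 + b 2) / 2` and `(1 - b 2) / 2` of the projection sum to `1`, so some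
basis vector projects to a nonzero vector of the fibre line over `b`. -/
theorem hopfMap_surjective : Function.Surjective hopfMap := by
  intro b
  let e : Fin 2 → S3 := fun i => ⟨EuclideanSpace.single i 1, by simp⟩
  obtain ⟨i, hi⟩ : ∃ i, fiberProj b (e i) ≠ 0 := by
    by_contra! h
    have h0 := congrArg (fun v : EuclideanSpace ℂ (Fin 2) => (v 0).re) (h 0)
    have h1 := congrArg (fun v : EuclideanSpace ℂ (Fin 2) => (v 1).re) (h 1)
    simp [fiberProj, e] at h0 h1
    linarith
  obtain ⟨G, -, hG⟩ := exists_lift_of_fiberProj_ne_zero (X := Unit) (G := fun _ => e i)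
    continuous_const (k := fun _ => b) continuous_const fun _ => hi
  exact ⟨G (), hG ()⟩

/-- A map from Euclidean space to `S²` lifts through the Hopf map over every ball. -/
theorem exists_hopf_lift {E : Type*} [NormedAddCommGroup E] [InnerProductSpace ℝ E]
    [FiniteDimensional ℝ E] {g : E → S2} (hg : Continuous g) {R : ℝ} (hR : 0 < R) :
    ∃ G : E → S3, Continuous G ∧ ∀ y, ‖y‖ ≤ R → hopfMap (G y) = g y := by
  have hu := (isCompact_closedBall (0 : E) R).uniformContinuousOn_of_continuous hg.continuousOn
  obtain ⟨δ, hδ, hgδ⟩ := Metric.uniformContinuousOn_iff.1 hu 2 two_pos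
  obtain ⟨N, hN⟩ := exists_nat_gt (R / δ)
  have hN0 : (0 : ℝ) < N := (by positivity : 0 < R / δ).trans hN
  -- A discretized radial homotopy from the constant `g 0` to `g`. As `N > R / δ`, consecutive
  -- stages are evaluated at points less than `δ` apart, hence are nowhere antipodal.
  let k : ℕ → E → S2 := fun j y => g ((j / N : ℝ) • radialRetraction R y)
  have hmem : ∀ j ≤ N, ∀ y, (j / N : ℝ) • radialRetraction R y ∈ closedBall (0 : E) R := by
    intro j hj y
    rw [mem_closedBall_zero_iff, norm_smul, Real.norm_of_nonneg (by positivity)]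
    have h1 : (j / N : ℝ) ≤ 1 := (div_le_one hN0).2 (by exact_mod_cast hj)
    exact (mul_le_of_le_one_left (norm_nonneg _) h1).trans (norm_radialRetraction_le hR y)
  obtain ⟨v, hv⟩ := hopfMap_surjective (g 0)
  obtain ⟨G, hG, hGk⟩ := exists_lift_of_chain (k := k) (N := N)
    (fun j => hg.comp ((continuous_radialRetraction hR).const_smul _))
    (fun j hj y => hgδ _ (hmem _ hj y) _ (hmem _ hj.le y) (by
      rw [dist_eq_norm, ← sub_smul, norm_smul]
      have h1 : ((j + 1 : ℕ) / N - j / N : ℝ) = 1 / N := by push_cast; ring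
      rw [h1, Real.norm_of_nonneg (by positivity), one_div, inv_mul_lt_iff₀ hN0]
      exact (norm_radialRetraction_le hR y).trans_lt ((div_lt_iff₀ hδ).1 hN)))
    ⟨fun _ => v, continuous_const, fun y => by simp [k, hv]⟩
  refine ⟨G, hG, fun y hy => ?_⟩
  rw [hGk]
  simp only [k]
  rw [div_self hN0.ne', one_smul, radialRetraction_of_norm_le hR hy]

/-- The reversed contraction deforms a constant map into `u`; the covering `Circle.exp` lifts this
homotopy from a constant start, and its end lifts `u`. -/
theorem exists_circle_lift [ContractibleSpace X] {u : X → Circle} (hu : Continuous u) :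
    ∃ θ : X → ℝ, Continuous θ ∧ ∀ x, Circle.exp (θ x) = u x := by
  obtain ⟨x₀, ⟨F⟩⟩ := id_nullhomotopic X
  obtain ⟨s, hs⟩ := Circle.exp_surjective (u x₀)
  let H : C(unitInterval × X, Circle) := (⟨u, hu⟩ : C(X, Circle)).comp F.symm.toContinuousMap
  let Θ := Circle.isCoveringMap_exp.liftHomotopy H (.const X s) fun x => by simp [H, hs]
  refine ⟨fun x => Θ (1, x), Θ.continuous.comp (by fun_prop), fun x => ?_⟩
  have := congrFun (Circle.isCoveringMap_exp.liftHomotopy_lifts H (.const X s)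
    fun x => by simp [H, hs]) (1, x)
  exact this.trans (congrArg u (by simp [F.symm.apply_one]))

end Lift

/-- Points of the same Hopf fibre differ by a phase. -/
theorem eq_inner_smul_of_hopfMap_eq {p p' : S3} (h : hopfMap p = hopfMap p') :
    (p' : EuclideanSpace ℂ (Fin 2)) =
      (inner ℂ (p : EuclideanSpace ℂ (Fin 2)) (p' : EuclideanSpace ℂ (Fin 2))) •
        (p : EuclideanSpace ℂ (Fin 2)) := by
  obtain ⟨p, hp⟩ := p
  obtain ⟨p', hp'⟩ := p'
  have hv : hopfVec p = hopfVec p' := congrArg Subtype.val h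
  have h0 := congrArg (fun v : EuclideanSpace ℝ (Fin 3) => v 0) hv
  have h1 := congrArg (fun v : EuclideanSpace ℝ (Fin 3) => v 1) hv
  have h2 := congrArg (fun v : EuclideanSpace ℝ (Fin 3) => v 2) hv
  simp only [hopfVec, PiLp.toLp_apply, Matrix.cons_val] at h0 h1 h2
  have hn := EuclideanSpace.norm_sq_eq p
  have hn' := EuclideanSpace.norm_sq_eq p'
  rw [mem_sphere_zero_iff_norm.1 hp, Fin.sum_univ_two] at hn
  rw [mem_sphere_zero_iff_norm.1 hp', Fin.sum_univ_two] at hn'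
  have hz : p 0 * starRingEnd ℂ (p 1) = p' 0 * starRingEnd ℂ (p' 1) :=
    Complex.ext (by linarith) (by linarith)
  have hz' : p 1 * starRingEnd ℂ (p 0) = p' 1 * starRingEnd ℂ (p' 0) := by
    simpa [mul_comm] using congrArg (starRingEnd ℂ) hz
  simp only [← Complex.normSq_eq_norm_sq] at h2 hn hn'
  have ha : p 0 * starRingEnd ℂ (p 0) = p' 0 * starRingEnd ℂ (p' 0) := by
    rw [Complex.mul_conj, Complex.mul_conj,
      show Complex.normSq (p 0) = Complex.normSq (p' 0) by linarith]
  have hb : p 1 * starRingEnd ℂ (p 1) = p' 1 * starRingEnd ℂ (p' 1) := by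
    rw [Complex.mul_conj, Complex.mul_conj,
      show Complex.normSq (p 1) = Complex.normSq (p' 1) by linarith]
  have hs : p' 0 * starRingEnd ℂ (p' 0) + p' 1 * starRingEnd ℂ (p' 1) = 1 := by
    rw [Complex.mul_conj, Complex.mul_conj, ← Complex.ofReal_add, ← hn', one_pow,
      Complex.ofReal_one]
  -- The identities above say `p p* = p' p'*` as matrices, whence `p' = p' (p'* p') = p (p* p')`.
  ext i
  rw [PiLp.inner_apply, Fin.sum_univ_two, PiLp.smul_apply, smul_eq_mul]
  simp only [RCLike.inner_apply]
  fin_cases i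
  · change p' 0 = (_ + _) * p 0
    linear_combination -p' 0 * hs - p' 0 * ha - p' 1 * hz
  · change p' 1 = (_ + _) * p 1
    linear_combination -p' 1 * hs - p' 1 * hb - p' 0 * hz'

/-- Two maps into `S³` with the same composite to `S²` differ by a continuous phase, which lifts to
an angle if the source is contractible. -/
theorem exists_angle {X : Type*} [TopologicalSpace X] [ContractibleSpace X] {p p' : X → S3}
    (hp : Continuous p) (hp' : Continuous p') (h : ∀ x, hopfMap (p x) = hopfMap (p' x)) :
    ∃ θ : X → ℝ, Continuous θ ∧ ∀ x, (p' x : EuclideanSpace ℂ (Fin 2)) =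
      (Circle.exp (θ x) : ℂ) • (p x : EuclideanSpace ℂ (Fin 2)) := by
  let u : X → ℂ := fun x =>
    inner ℂ (p x : EuclideanSpace ℂ (Fin 2)) (p' x : EuclideanSpace ℂ (Fin 2))
  have hu : Continuous u :=
    (continuous_subtype_val.comp hp).inner (continuous_subtype_val.comp hp')
  have hpu : ∀ x, (p' x : EuclideanSpace ℂ (Fin 2)) = u x • (p x : EuclideanSpace ℂ (Fin 2)) :=
    fun x => eq_inner_smul_of_hopfMap_eq (h x)
  have hu1 : ∀ x, u x ∈ Submonoid.unitSphere ℂ := fun x => by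
    have := congrArg norm (hpu x)
    rw [norm_smul, norm_eq_of_mem_sphere, norm_eq_of_mem_sphere, mul_one] at this
    exact mem_sphere_zero_iff_norm.2 this.symm
  obtain ⟨θ, hθ, hθu⟩ := exists_circle_lift (u := fun x => (⟨u x, hu1 x⟩ : Circle))
    (hu.subtype_mk _)
  exact ⟨θ, hθ, fun x => by rw [hθu]; exact hpu x⟩

theorem range_softmax (n : ℕ) : range (softmax n) = (simplexBoundary n)ᶜ := by
  rw [← image_univ]
  exact (softmax n).image_source_eq_target

end HopfSimplex
end

/-! ### The map to `ℝ² × ℝ` and the contradiction on a vertical line -/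

open HopfSimplex Set

theorem mainTheorem5 (q : HopfSimplex.Simplex 3 → HopfSimplex.S3)
    (hq : HopfSimplex.IsCollapse (HopfSimplex.simplexBoundary 3) q) :
    ¬ HopfSimplex.FactorsOver 2 (HopfSimplex.hopfMap ∘ q) := by
  rintro ⟨f', g, hf', hg, hfg⟩
  have hqc : Continuous q := hq.isQuotientMap.continuous
  have : ContractibleSpace (Simplex 3) :=
    (convex_stdSimplex ℝ (Fin 4)).contractibleSpace ⟨_, single_mem_stdSimplex ℝ 0⟩
  obtain ⟨R, hR⟩ := (isCompact_range hf').isBounded.exists_pos_norm_le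
  obtain ⟨G, hG, hGg⟩ := exists_hopf_lift hg hR.1
  have hlift : ∀ x, hopfMap (G (f' x)) = hopfMap (q x) := fun x =>
    (hGg _ (hR.2 _ (mem_range_self x))).trans (congrFun hfg x).symm
  obtain ⟨θ, hθ, hqθ⟩ := exists_angle (hG.comp hf') hqc hlift
  let F : Simplex 3 → EuclideanSpace ℝ (Fin 2) × ℝ := fun x => (f' x, θ x)
  have hF : Continuous F := hf'.prodMk hθ
  have hFq : ∀ x y, F x = F y → q x = q y := fun x y hxy => by
    obtain ⟨h1, h2⟩ := Prod.mk.inj hxy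
    apply Subtype.ext
    rw [hqθ x, hqθ y, Function.comp_apply, Function.comp_apply, h1, h2]
  have hs : Topology.IsOpenEmbedding (softmax 3) := (softmax 3).isOpenEmbedding rfl
  have hmem : ∀ v, softmax 3 v ∉ simplexBoundary 3 := fun v => by
    change softmax 3 v ∈ (simplexBoundary 3)ᶜ
    rw [← range_softmax]
    exact mem_range_self v
  -- On the open simplex `q` is injective and factors through `F`, so `F` is injective there;
  -- `softmax 3` makes its source a vector space.
  have hopen : IsOpen (range (F ∘ softmax 3)) := isOpen_range_of_finrank_eq (by simp)
    (hF.comp hs.continuous) fun v w hvw => by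
      rcases (hq.eq_iff _ _).1 (hFq _ _ hvw) with h | h
      · exact hs.injective h
      · exact absurd h.1 (hmem v)
  -- a fibre of the Hopf map that does not meet the image of the boundary
  have hbd : (⟨Pi.single 0 1, single_mem_stdSimplex ℝ 0⟩ : Simplex 3) ∈ simplexBoundary 3 :=
    ⟨1, by simp⟩
  set c : Simplex 3 := ⟨Pi.single 0 1, single_mem_stdSimplex ℝ 0⟩
  have hconst : ∀ x ∈ simplexBoundary 3, g (f' x) = hopfMap (q c) := fun x hx => by
    rw [← (hq.eq_iff x c).2 (Or.inr ⟨hx, hbd⟩)]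
    exact (congrFun hfg x).symm
  -- The antipode merely serves as a value other than the one taken on the boundary.
  obtain ⟨p, hp⟩ := hopfMap_surjective (-hopfMap (q c))
  obtain ⟨x₀, rfl⟩ := hq.isQuotientMap.surjective p
  have hx₀ : g (f' x₀) ≠ hopfMap (q c) := by
    rw [show g (f' x₀) = hopfMap (q x₀) from (congrFun hfg x₀).symm, hp]
    exact (ne_neg_of_mem_unit_sphere ℝ (hopfMap (q c))).symm
  let S : Set ℝ := {s | (f' x₀, s) ∈ range (F ∘ softmax 3)}
  -- No boundary point lies over `f' x₀`, since `g` takes a different value there. Hence `S` is open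
  -- as a slice of the open image and closed as a slice of the compact one.
  have hSF : S = {s | (f' x₀, s) ∈ range F} := by
    ext s
    refine ⟨fun ⟨v, hv⟩ => ⟨_, hv⟩, fun ⟨x, hx⟩ => ?_⟩
    have hxf : f' x = f' x₀ := congrArg Prod.fst hx
    have hxb : x ∈ (simplexBoundary 3)ᶜ := fun hb => hx₀ (hxf ▸ hconst x hb)
    rw [← range_softmax] at hxb
    obtain ⟨v, rfl⟩ := hxb
    exact ⟨v, hx⟩
  have hcont : Continuous fun s : ℝ => (f' x₀, s) := Continuous.prodMk_right _
  have hSo : IsOpen S := hopen.preimage hcont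
  have hSc : IsClosed S := hSF ▸ (isCompact_range hF).isClosed.preimage hcont
  have hSu : S = univ := IsClopen.eq_univ ⟨hSc, hSo⟩ ⟨θ x₀, by
    rw [hSF]
    exact ⟨x₀, rfl⟩⟩
  have hθu : range θ = univ := eq_univ_of_forall fun s => by
    obtain ⟨v, hv⟩ : s ∈ S := hSu ▸ mem_univ s
    exact ⟨_, congrArg Prod.snd hv⟩
  exact noncompact_univ ℝ (hθu ▸ isCompact_range hθ)
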